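/- **Definitions.** Let $\Pr$ be a probability distribution of binary random variables $X_1,\dots,X_n$. Its probability generating polynomial is $$g(z_1,\dots,z_n)=\sum_{S\subseteq\{1,\dots,n\}}\Pr(\{X_i=1\}_{i\in S},\{X_i=0\}_{i\notin S})\prod_{i\in S}z_i\in\mathbb{R}[z_1,\dots,z_n].$$ A probabilistic generating circuit (PGC) is a finite directed acyclic graph, with edges directed from children to parents, whose nodes are leaves (a variable $z_i$ or a real constant), sum nodes with real-weighted edges from their children, and product nodes with unweighted edges from their children, and in which exactly one node, the root, has out-degree $0$. A leaf represents the polynomial $z_i$ or the constant, a sum node the weighted sum and a product node the product of the polynomials represented by its children; the PGC represents the polynomial represented by its root. The size of a PGC is the number of its edges. A PGC represents $\Pr$ if it represents the probability generating polynomial of $\Pr$. Time is the number of steps of a real RAM, which has registers for natural numbers and for real numbers, direct and indirect addressing, and conditional jumps; it adds, subtracts, multiplies and divides real numbers exactly, and adds and subtracts natural numbers, in one step per operation. A PGC is given to it as the list of its nodes in a bottom-up order (children before parents), with the kind, the children, and the real constant or edge weights of each node; sets $A,B$ are given by one number for each variable. **Theorem.** There are a single real RAM program and a constant $C$ such that the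 following holds. For every $n$, every PGC of size $m$ that represents a probability distribution $\Pr$ of $n$ binary random variables, and all disjoint $A,B\subseteq\{1,\dots,n\}$, the program, given the PGC and $A,B$, halts with the output $$\Pr(\{X_i=1\}_{i\in A},\{X_i=0\}_{i\in B})$$ (for $A\cup B=\{1,\dots,n\}$ this is the likelihood of an assignment), in time $O(mn\log n\log\log n)$: the number of steps is at most $C\,mn\log n\log\log n$ whenever $m\ge1$ and $n\ge3$, and in all cases, including the degenerate ones, at most $C\max(1,m)\max(1,n)\max(1,\log n)\max(1,\log\log n)$ (where $\max(1,\log n)=\max(1,\log\log n)=1$ for $n\le 1$). -/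

import Mathlib

open MeasureTheory

noncomputable section

/-! ### Probability generating polynomials of binary random variables -/

/-- The marginal probability `Pr({X_i = 1}_{i ∈ A}, {X_i = 0}_{i ∈ B})` of a probability
distribution `μ` of binary random variables `X_1, …, X_n`
(the value 1 is `true`, the value 0 is `false`). -/
def marginal {n : ℕ} (μ : Measure (Fin n → Bool)) (A B : Finset (Fin n)) : ℝ :=
  μ.real {x | (∀ i ∈ A, x i = true) ∧ (∀ i ∈ B, x i = false)}

/-- The probability generating polynomial `∑_S α_S ∏_{i ∈ S} z_i`, where
`α_S = Pr({X_i = 1}_{i ∈ S}, {X_i = 0}_{i ∉ S})`. -/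
def generatingPolynomial {n : ℕ} (μ : Measure (Fin n → Bool)) : MvPolynomial (Fin n) ℝ :=
  ∑ S : Finset (Fin n), MvPolynomial.C (marginal μ S Sᶜ) * ∏ i ∈ S, MvPolynomial.X i

/-! ### Probabilistic generating circuits -/

/-- What stands at a node of a probabilistic generating circuit with node set `V`: a leaf
(a variable `z_i` or a constant), a sum over weighted edges, or a product over unweighted edges.
The lists hold the children of the node. -/
inductive PGCGate (n : ℕ) (V : Type) : Type
  | var (i : Fin n)
  | const (c : ℝ)
  | sum (l : List (ℝ × V))
  | prod (l : List V)

namespace PGCGate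

variable {n : ℕ} {V : Type}

/-- The children of a node; each entry of the list is one edge of the circuit. -/
def children : PGCGate n V → List V
  | var _ => []
  | const _ => []
  | sum l => l.map Prod.snd
  | prod l => l

/-- The polynomial represented by a node, from the polynomials represented by its children. -/
def combine : PGCGate n V → (V → MvPolynomial (Fin n) ℝ) → MvPolynomial (Fin n) ℝ
  | var i, _ => MvPolynomial.X i
  | const c, _ => MvPolynomial.C c
  | sum l, f => (l.map fun a => MvPolynomial.C a.1 * f a.2).sum
  | prod l, f => (l.map f).prod

theorem combine_congr (g : PGCGate n V) (f f' : V → MvPolynomial (Fin n) ℝ)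
    (h : ∀ u ∈ g.children, f u = f' u) : g.combine f = g.combine f' := by
  cases g with
  | var i => rfl
  | const c => rfl
  | sum l =>
    refine congrArg List.sum (List.map_congr_left fun a ha => ?_)
    rw [h a.2 (List.mem_map_of_mem ha)]
  | prod l => exact congrArg List.prod (List.map_congr_left h)

end PGCGate

/-- A probabilistic generating circuit in the variables `z_1, …, z_n`: a finite directed acyclic
graph of gates (edges go from children to parents) in which exactly one node, the root, has
out-degree 0. -/
structure PGC (n : ℕ) : Type 1 where
  Node : Type
  [fintypeNode : Fintype Node]
  gate : Node → PGCGate n Node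
  acyclic : WellFounded fun u v => u ∈ (gate v).children
  root : Node
  no_parent_iff : ∀ u, (∀ v, u ∉ (gate v).children) ↔ u = root

namespace PGC

attribute [instance] PGC.fintypeNode

variable {n : ℕ}

/-- The size of a circuit: its number of edges. -/
def size (P : PGC n) : ℕ := ∑ v, (P.gate v).children.length

open Classical in
/-- The polynomial represented by a node, by recursion along the edges. -/
def nodePolynomial (P : PGC n) : P.Node → MvPolynomial (Fin n) ℝ :=
  P.acyclic.fix fun v f =>
    (P.gate v).combine fun u => if h : u ∈ (P.gate v).children then f u h else 0

theorem nodePolynomial_eq (P : PGC n) (v : P.Node) :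
    P.nodePolynomial v = (P.gate v).combine P.nodePolynomial := by
  unfold nodePolynomial
  rw [WellFounded.fix_eq]
  refine PGCGate.combine_congr _ _ _ fun u hu => ?_
  rw [dif_pos hu]

/-- The polynomial represented by a circuit is the one represented by its root. -/
def polynomial (P : PGC n) : MvPolynomial (Fin n) ℝ := P.nodePolynomial P.root

/-- A bottom-up (topological) numbering of the nodes: children come before their parents. -/
structure BottomUpOrder (P : PGC n) where
  toEquiv : Fin (Fintype.card P.Node) ≃ P.Node
  lt_of_child : ∀ u v, u ∈ (P.gate v).children → toEquiv.symm u < toEquiv.symm v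

/-- Every circuit has a bottom-up numbering. -/
theorem nonempty_bottomUpOrder (P : PGC n) : Nonempty P.BottomUpOrder := by
  classical
  let r : P.Node → P.Node → Prop := fun u v => u ∈ (P.gate v).children
  have hwf : WellFounded (Relation.TransGen r) := P.acyclic.transGen
  have hirr : ∀ a, ¬ Relation.TransGen r a a := fun a h => hwf.irrefl.irrefl a h
  have hpo : IsPartialOrder P.Node (Relation.ReflTransGen r) :=
    { refl := fun _ => .refl
      trans := fun _ _ _ => .trans
      antisymm := fun a b hab hba => by
        by_contra hne
        have h1 := (Relation.reflTransGen_iff_eq_or_transGen.1 hab).resolve_left (Ne.symm hne)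
        exact hirr a (h1.trans_left hba) }
  obtain ⟨s, hs, hrs⟩ := extend_partialOrder (Relation.ReflTransGen r)
  let L : LinearOrder P.Node :=
    { le := s
      le_refl := hs.refl
      le_trans := hs.trans
      le_antisymm := hs.antisymm
      le_total := hs.total
      toDecidableLE := Classical.decRel _ }
  let e := monoEquivOfFin P.Node rfl
  refine ⟨⟨e.toEquiv, fun u v huv => ?_⟩⟩
  have hlt : u < v := lt_of_le_of_ne (hrs _ _ (Relation.ReflTransGen.single huv))
    fun h => hirr v (.single (h ▸ huv))
  exact e.symm.lt_iff_lt.2 hlt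

end PGC

/-! ### The real RAM

Registers hold natural numbers (used for indices and control) or real numbers.  Every instruction,
in particular every exact arithmetic operation on real numbers, takes one step.  The input
consists of a read-only array of natural numbers and a read-only array of real numbers. -/

namespace RealRAM

/-- The instructions.  `w i` and `r i` are the `i`-th natural and real register, and `l` is the
position of an instruction in the program. -/
inductive Instr : Type
  /-- `w i := c` -/
  | wconst (i c : ℕ)
  /-- `w i := w j + w k` -/
  | wadd (i j k : ℕ)
  /-- `w i := w j - w k`, or 0 when this is negative -/
  | wsub (i j k : ℕ)
  /-- `w i := w (w j)` -/
  | wload (i j : ℕ)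
  /-- `w (w i) := w j` -/
  | wstore (i j : ℕ)
  /-- `w i := ` the natural input number at position `w j` (0 beyond the end) -/
  | wread (i j : ℕ)
  /-- `r i := c` -/
  | rconst (i : ℕ) (c : ℤ)
  /-- `r i := r j + r k` -/
  | radd (i j k : ℕ)
  /-- `r i := r j - r k` -/
  | rsub (i j k : ℕ)
  /-- `r i := r j * r k` -/
  | rmul (i j k : ℕ)
  /-- `r i := r j / r k`; the machine gets stuck and never halts when `r k = 0` -/
  | rdiv (i j k : ℕ)
  /-- `r i := r (w j)` -/
  | rload (i j : ℕ)
  /-- `r (w i) := r j` -/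
  | rstore (i j : ℕ)
  /-- `r i := ` the real input number at position `w j` (0 beyond the end) -/
  | rread (i j : ℕ)
  /-- go to `l` -/
  | jump (l : ℕ)
  /-- go to `l` if `w i < w j` -/
  | jumpLt (i j l : ℕ)
  /-- go to `l` if `r i < 0` -/
  | jumpNeg (i l : ℕ)

/-- An input. -/
structure Input where
  words : List ℕ
  reals : List ℝ

/-- A configuration: the position in the program and the contents of the registers. -/
structure Config where
  pc : ℕ
  w : ℕ → ℕ
  r : ℕ → ℝ

/-- The configuration with `w i` overwritten, at the next instruction. -/
def Config.setW (c : Config) (i x : ℕ) : Config :=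
  { c with pc := c.pc + 1, w := Function.update c.w i x }

/-- The configuration with `r i` overwritten, at the next instruction. -/
def Config.setR (c : Config) (i : ℕ) (x : ℝ) : Config :=
  { c with pc := c.pc + 1, r := Function.update c.r i x }

open Classical in
/-- The effect of one instruction. -/
def exec (inp : Input) (c : Config) : Instr → Config
  | .wconst i a => c.setW i a
  | .wadd i j k => c.setW i (c.w j + c.w k)
  | .wsub i j k => c.setW i (c.w j - c.w k)
  | .wload i j => c.setW i (c.w (c.w j))
  | .wstore i j => c.setW (c.w i) (c.w j)
  | .wread i j => c.setW i (inp.words.getD (c.w j) 0)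
  | .rconst i a => c.setR i a
  | .radd i j k => c.setR i (c.r j + c.r k)
  | .rsub i j k => c.setR i (c.r j - c.r k)
  | .rmul i j k => c.setR i (c.r j * c.r k)
  | .rdiv i j k => if c.r k = 0 then c else c.setR i (c.r j / c.r k)
  | .rload i j => c.setR i (c.r (c.w j))
  | .rstore i j => c.setR (c.w i) (c.r j)
  | .rread i j => c.setR i (inp.reals.getD (c.w j) 0)
  | .jump l => { c with pc := l }
  | .jumpLt i j l => { c with pc := if c.w i < c.w j then l else c.pc + 1 }
  | .jumpNeg i l => { c with pc := if c.r i < 0 then l else c.pc + 1 }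

/-- One step of a program; nothing changes once the position is beyond its end. -/
def step (prog : List Instr) (inp : Input) (c : Config) : Config :=
  match prog[c.pc]? with
  | some a => exec inp c a
  | none => c

/-- The program starts at its first instruction, with all registers 0. -/
def start : Config := ⟨0, fun _ => 0, fun _ => 0⟩

/-- On the input `inp`, the program halts after at most `t` steps (its position is then beyond
its end), with the output `y` in the real register 0. -/
def ComputesWithin (prog : List Instr) (inp : Input) (t : ℕ) (y : ℝ) : Prop :=
  prog.length ≤ ((step prog inp)^[t] start).pc ∧ ((step prog inp)^[t] start).r 0 = y

end RealRAM

/-! ### Circuits and queries as inputs of the real RAM -/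

namespace PGCGate

variable {n : ℕ} {V : Type}

/-- The natural numbers that describe a gate: its kind, then the index of the variable, or the
number of the children and their indices. -/
def words (idx : V → ℕ) : PGCGate n V → List ℕ
  | var i => [0, i]
  | const _ => [1]
  | sum l => 2 :: l.length :: l.map fun a => idx a.2
  | prod l => 3 :: l.length :: l.map idx

/-- The real numbers that describe a gate: the constant of a constant leaf, the weights of the
edges into a sum node. -/
def reals : PGCGate n V → List ℝ
  | var _ => []
  | const c => [c]
  | sum l => l.map Prod.fst
  | prod _ => []

end PGCGate

/-- The input that consists of a circuit, whose nodes are listed bottom-up, and of the query for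
the marginal probability `Pr({X_i = 1}_{i ∈ A}, {X_i = 0}_{i ∈ B})`: the number of variables, the
number of nodes, one number for each variable (1 on `A`, 2 on `B`, else 0), and the gates. -/
def PGC.encode {n : ℕ} (P : PGC n) (e : P.BottomUpOrder) (A B : Finset (Fin n)) :
    RealRAM.Input where
  words := n :: Fintype.card P.Node ::
    ((List.ofFn fun i : Fin n => if i ∈ A then 1 else if i ∈ B then 2 else 0) ++
      (List.ofFn fun j => (P.gate (e.toEquiv j)).words fun v => (e.toEquiv.symm v : ℕ)).flatten)
  reals := (List.ofFn fun j => (P.gate (e.toEquiv j)).reals).flatten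

end

/-!
Restrict the generating polynomial to the line `z_i = x` for `i ∈ A`, `z_i = 0` for `i ∈ B` and
`z_i = 1` for all other `i`. The restriction is a univariate polynomial of degree at most
`k = |A|`, and the sets that contribute to its coefficient of `x ^ k` are the `S ⊇ A` that are
disjoint from `B`; so this coefficient is the marginal probability. The coefficient of `x ^ k` of a
polynomial of degree at most `k` is its `k`-th finite difference divided by `k!`, a weighted sum of
the values at `0, …, k`. Each of these `k + 1 ≤ n + 1` values takes one pass over the circuit, in
time `O(m)`, and the weights satisfy a recurrence that updates them in constant time. The whole
computation takes time `O(mn)`, without the logarithmic factors.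
-/

section FiniteDifferences

/-- The weight of the value at `j` in the `k`-th finite difference at `0`, divided by `k!`. -/
noncomputable def differenceWeight (k j : ℕ) : ℝ :=
  (-1) ^ (k + j) * k.choose j / k.factorial

theorem differenceWeight_zero_zero : differenceWeight 0 0 = 1 := by
  simp [differenceWeight]

theorem differenceWeight_succ_zero (k : ℕ) :
    differenceWeight (k + 1) 0 = differenceWeight k 0 / (-k - 1) := by
  have hk : (-k - 1 : ℝ) ≠ 0 := by
    rw [← neg_add', neg_ne_zero]
    positivity
  simp only [differenceWeight, Nat.choose_zero_right, Nat.factorial_succ]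
  push_cast
  field_simp
  ring

theorem differenceWeight_succ (k j : ℕ) :
    differenceWeight k (j + 1) = differenceWeight k j * (j - k) / (j + 1) := by
  have hchoose : (k.choose (j + 1) : ℝ) * (j + 1) = k.choose j * (k - j) := by
    obtain hj | hj := le_or_gt j k
    · rw [← Nat.cast_sub hj]
      exact_mod_cast k.choose_succ_right_eq j
    · simp [Nat.choose_eq_zero_of_lt, hj, hj.trans j.lt_succ_self]
  rw [eq_div_iff (by positivity)]
  calc differenceWeight k (j + 1) * (j + 1)
      = -((-1) ^ (k + j) * (k.choose (j + 1) * (j + 1)) / k.factorial) := by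
        rw [differenceWeight]; ring
    _ = differenceWeight k j * (j - k) := by
        rw [hchoose, differenceWeight]; ring

theorem sum_differenceWeight_mul (k : ℕ) (f : ℝ → ℝ) :
    ∑ j ∈ Finset.range (k + 1), differenceWeight k j * f j =
      (fwdDiff 1)^[k] f 0 / k.factorial := by
  rw [fwdDiff_iter_eq_sum_shift, Finset.sum_div]
  refine Finset.sum_congr rfl fun j hj => ?_
  have hsign : (-1 : ℝ) ^ (k + j) = (-1) ^ (k - j) := by
    rw [show k + j = (k - j) + 2 * j by have := Finset.mem_range.1 hj; omega, pow_add, pow_mul,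
      neg_one_sq, one_pow, mul_one]
  rw [differenceWeight, hsign, zero_add, nsmul_one, zsmul_eq_mul]
  push_cast
  ring

theorem sum_differenceWeight_mul_pow {k i : ℕ} (h : i ≤ k) :
    ∑ j ∈ Finset.range (k + 1), differenceWeight k j * (j : ℝ) ^ i = if i = k then 1 else 0 := by
  rw [sum_differenceWeight_mul k (· ^ i)]
  split_ifs with hik
  · subst hik
    rw [fwdDiff_iter_eq_factorial, Pi.natCast_apply, div_self (by positivity)]
  · rw [fwdDiff_iter_pow_eq_zero_of_lt (h.lt_of_ne hik), Pi.zero_apply, zero_div]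

end FiniteDifferences

section Marginal

variable {n : ℕ} {A B : Finset (Fin n)}

theorem marginal_self_compl (μ : Measure (Fin n → Bool)) (S : Finset (Fin n)) :
    marginal μ S Sᶜ = μ.real {fun i => decide (i ∈ S)} := by
  refine congrArg μ.real (Set.ext fun x => ?_)
  simp only [Set.mem_ofPred_eq, Set.mem_singleton_iff, Finset.mem_compl, funext_iff]
  refine ⟨fun ⟨hS, hSc⟩ i => ?_, fun h => ⟨fun i hi => ?_, fun i hi => ?_⟩⟩
  · by_cases hi : i ∈ S
    · simp [hi, hS i hi]
    · simp [hi, hSc i hi]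
  · simp [h, hi]
  · simp [h, hi]

theorem marginal_eq_sum (μ : Measure (Fin n → Bool)) [IsFiniteMeasure μ] (A B : Finset (Fin n)) :
    marginal μ A B = ∑ S with Disjoint S B ∧ A ⊆ S, marginal μ S Sᶜ := by
  classical
  calc marginal μ A B
      = ∑ x : Fin n → Bool with (∀ i ∈ A, x i = true) ∧ ∀ i ∈ B, x i = false, μ.real {x} := by
        rw [sum_measureReal_singleton, Finset.coe_filter_univ]
        rfl
    _ = ∑ S with Disjoint S B ∧ A ⊆ S, marginal μ S Sᶜ := by
        refine Finset.sum_nbij' (fun x => ({i | x i = true} : Finset (Fin n)))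
          (fun S i => decide (i ∈ S)) ?_ ?_ ?_ ?_ ?_
        · simp +contextual [Finset.disjoint_right, Finset.subset_iff]
        · simp +contextual [Finset.disjoint_right, Finset.subset_iff]
        · simp
        · simp
        · exact fun x _ => by simp only [marginal_self_compl, Finset.mem_filter_univ,
            Bool.decide_eq_true]

/-- The point at which a query for `A` and `B` evaluates a generating polynomial. -/
def queryPoint (A B : Finset (Fin n)) (x : ℝ) (i : Fin n) : ℝ :=
  if i ∈ A then x else if i ∈ B then 0 else 1

theorem prod_queryPoint (hAB : Disjoint A B) (S : Finset (Fin n)) (x : ℝ) :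
    ∏ i ∈ S, queryPoint A B x i = if Disjoint S B then x ^ (S ∩ A).card else 0 := by
  split_ifs with h
  · calc ∏ i ∈ S, queryPoint A B x i
        = ∏ i ∈ S, if i ∈ A then x else 1 := Finset.prod_congr rfl fun i hi => by
          rw [queryPoint, if_neg (Finset.disjoint_left.1 h hi)]
      _ = x ^ (S ∩ A).card := by rw [Finset.prod_ite_mem, Finset.prod_const]
  · obtain ⟨i, hiS, hiB⟩ := Finset.not_disjoint_iff.1 h
    refine Finset.prod_eq_zero hiS ?_
    rw [queryPoint, if_neg (Finset.disjoint_right.1 hAB hiB), if_pos hiB]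

theorem eval_generatingPolynomial (μ : Measure (Fin n → Bool)) (z : Fin n → ℝ) :
    (generatingPolynomial μ).eval z = ∑ S : Finset (Fin n), marginal μ S Sᶜ * ∏ i ∈ S, z i := by
  simp [generatingPolynomial]

/-- Only the sets `S` with `A ⊆ S` and `S ∩ B = ∅` contribute to the coefficient of `x ^ |A|` in
the restriction of the generating polynomial to the query points. -/
theorem sum_differenceWeight_mul_eval_generatingPolynomial (μ : Measure (Fin n → Bool))
    [IsFiniteMeasure μ] (hAB : Disjoint A B) :
    ∑ j ∈ Finset.range (A.card + 1),
      differenceWeight A.card j * (generatingPolynomial μ).eval (queryPoint A B j) =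
        marginal μ A B := by
  simp only [eval_generatingPolynomial, prod_queryPoint hAB, Finset.mul_sum]
  rw [Finset.sum_comm, marginal_eq_sum, Finset.sum_filter]
  refine Finset.sum_congr rfl fun S _ => ?_
  by_cases hS : Disjoint S B
  · have hcard : (S ∩ A).card = A.card ↔ A ⊆ S := by
      rw [← Finset.inter_eq_right]
      exact ⟨fun h => Finset.eq_of_subset_of_card_le Finset.inter_subset_right h.ge,
        congrArg Finset.card⟩
    simp only [hS, if_true, true_and, mul_left_comm _ (marginal μ S Sᶜ), ← Finset.mul_sum,
      sum_differenceWeight_mul_pow (Finset.card_le_card Finset.inter_subset_right), hcard,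
      mul_ite, mul_one, mul_zero]
  · simp only [hS, if_false, false_and, mul_zero, Finset.sum_const_zero]

end Marginal

namespace RealRAM

/-- The contents of the registers. Assertions about programs refer to it alone, so that they do
not depend on the position at which the code stands. -/
structure Memory where
  w : ℕ → ℕ
  r : ℕ → ℝ

/-- The contents of the registers in a configuration. -/
def Config.mem (c : Config) : Memory := ⟨c.w, c.r⟩

namespace Memory

variable {m m' m'' : Memory} {W R : Set ℕ} {i : ℕ}

/-- The configuration that stands at position `p` with the memory `m`. -/
def atPos (m : Memory) (p : ℕ) : Config := ⟨p, m.w, m.r⟩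

/-- Writes to a register for natural numbers. -/
def setW (m : Memory) (i x : ℕ) : Memory := { m with w := Function.update m.w i x }

/-- Writes to a register for real numbers. -/
noncomputable def setR (m : Memory) (i : ℕ) (x : ℝ) : Memory :=
  { m with r := Function.update m.r i x }

theorem atPos_pc (p : ℕ) : (m.atPos p).pc = p := rfl

@[simp] theorem setW_w (x j : ℕ) : (m.setW i x).w j = if j = i then x else m.w j :=
  Function.update_apply ..
@[simp] theorem setW_r (x : ℕ) : (m.setW i x).r = m.r := rfl
@[simp] theorem setR_w (x : ℝ) : (m.setR i x).w = m.w := rfl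
@[simp] theorem setR_r (x : ℝ) (j : ℕ) : (m.setR i x).r j = if j = i then x else m.r j :=
  Function.update_apply ..

/-- The memories agree outside the natural registers in `W` and the real registers in `R`: the
frame condition of a piece of code that writes only to these registers. -/
structure EqOff (W R : Set ℕ) (m m' : Memory) : Prop where
  w : ∀ i ∉ W, m'.w i = m.w i
  r : ∀ i ∉ R, m'.r i = m.r i

namespace EqOff

@[simp] theorem refl : EqOff W R m m := ⟨fun _ _ => rfl, fun _ _ => rfl⟩

theorem trans (h : EqOff W R m m') (h' : EqOff W R m' m'') : EqOff W R m m'' :=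
  ⟨fun i hi => (h'.w i hi).trans (h.w i hi), fun i hi => (h'.r i hi).trans (h.r i hi)⟩

theorem mono {W' R' : Set ℕ} (h : EqOff W R m m') (hW : W ⊆ W') (hR : R ⊆ R') :
    EqOff W' R' m m' :=
  ⟨fun i hi => h.w i (mt (@hW i) hi), fun i hi => h.r i (mt (@hR i) hi)⟩

@[simp] theorem setW_iff (hi : i ∈ W) {x : ℕ} : EqOff W R m (m'.setW i x) ↔ EqOff W R m m' := by
  refine ⟨fun h => ⟨fun j hj => ?_, h.r⟩, fun h => ⟨fun j hj => ?_, h.r⟩⟩ <;>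
  simpa [ne_of_mem_of_not_mem hi hj |>.symm] using h.w j hj

@[simp] theorem setR_iff (hi : i ∈ R) {x : ℝ} : EqOff W R m (m'.setR i x) ↔ EqOff W R m m' := by
  refine ⟨fun h => ⟨h.w, fun j hj => ?_⟩, fun h => ⟨h.w, fun j hj => ?_⟩⟩ <;>
  simpa [ne_of_mem_of_not_mem hi hj |>.symm] using h.r j hj

end EqOff

end Memory

/-- From `c`, the program reaches within `t` steps a configuration that satisfies `Q`. -/
def Reaches (prog : List Instr) (inp : Input) (c : Config) (t : ℕ) (Q : Config → Prop) : Prop :=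
  ∃ s ≤ t, Q ((step prog inp)^[s] c)

namespace Reaches

variable {prog : List Instr} {inp : Input} {c : Config} {t t' : ℕ} {Q Q' : Config → Prop}

theorem refl (h : Q c) : Reaches prog inp c t Q := ⟨0, t.zero_le, h⟩

theorem mono (h : Reaches prog inp c t Q) (ht : t ≤ t') (hQ : ∀ c', Q c' → Q' c') :
    Reaches prog inp c t' Q' :=
  let ⟨s, hs, hc⟩ := h
  ⟨s, hs.trans ht, hQ _ hc⟩

theorem trans (h : Reaches prog inp c t Q) (h' : ∀ c', Q c' → Reaches prog inp c' t' Q') :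
    Reaches prog inp c (t + t') Q' := by
  obtain ⟨s, hs, hc⟩ := h
  obtain ⟨s', hs', hc'⟩ := h' _ hc
  refine ⟨s' + s, by omega, ?_⟩
  rwa [Function.iterate_add_apply]

theorem next {a : Instr} (ha : prog[c.pc]? = some a)
    (h : Reaches prog inp (exec inp c a) t Q) : Reaches prog inp c (t + 1) Q := by
  obtain ⟨s, hs, hc⟩ := h
  refine ⟨s + 1, by omega, ?_⟩
  rw [Function.iterate_succ_apply]
  simpa only [step, ha] using hc

theorem jump {l : ℕ} (ha : prog[c.pc]? = some (.jump l)) (h : Q (c.mem.atPos l)) :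
    Reaches prog inp c 1 Q :=
  next ha (.refl h)

theorem jumpLt_of_lt {i j l : ℕ} (ha : prog[c.pc]? = some (.jumpLt i j l))
    (hij : c.mem.w i < c.mem.w j) (h : Reaches prog inp (c.mem.atPos l) t Q) :
    Reaches prog inp c (t + 1) Q :=
  next ha (by simp only [exec]; rwa [if_pos (show c.w i < c.w j from hij)])

theorem jumpLt_of_not_lt {i j l : ℕ} (ha : prog[c.pc]? = some (.jumpLt i j l))
    (hij : ¬ c.mem.w i < c.mem.w j) (h : Reaches prog inp (c.mem.atPos (c.pc + 1)) t Q) :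
    Reaches prog inp c (t + 1) Q :=
  next ha (by simp only [exec]; rwa [if_neg (show ¬ c.w i < c.w j from hij)])

end Reaches

/-- The list of instructions `l` stands in the program at position `p`. -/
def Placed (prog : List Instr) (p : ℕ) (l : List Instr) : Prop := l <+: prog.drop p

namespace Placed

variable {prog l l' : List Instr} {a : Instr} {p : ℕ}

theorem of_append (h : Placed prog p (l ++ l')) :
    Placed prog p l ∧ Placed prog (p + l.length) l' :=
  ⟨(List.prefix_append ..).trans h, by simpa [Placed] using List.IsPrefix.drop h l.length⟩

theorem of_cons (h : Placed prog p (a :: l)) : prog[p]? = some a ∧ Placed prog (p + 1) l :=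
  ⟨by
    obtain ⟨l', hl'⟩ := h
    have : (prog.drop p)[0]? = some a := by rw [← hl']; rfl
    simpa only [List.getElem?_drop, Nat.add_zero] using this, (of_append (l := [a]) h).2⟩

end Placed

/-- A piece of structured code. Jumps are absolute, so it is a function of the position at which
it is placed. -/
abbrev Code := ℕ → List Instr

namespace Code

/-- Straight-line code. -/
def block (l : List Instr) : Code := fun _ => l

/-- Sequential composition of code. -/
def seq (f g : Code) : Code := fun p => f p ++ g (p + (f p).length)

/-- The conditional on the comparison of two registers. The branch `g` for a failed test stands
first, and ends with a jump over the branch `f`. -/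
def ifLt (i j : ℕ) (f g : Code) : Code := fun p =>
  let elseBranch := g (p + 1)
  let thenPos := p + 1 + elseBranch.length + 1
  .jumpLt i j thenPos :: (elseBranch ++ .jump (thenPos + (f thenPos).length) :: f thenPos)

/-- The loop with body `f` that runs while register `i` is less than register `j`. The test
stands before the body and jumps over the exit jump, since `jumpLt` has no negated form. -/
def whileLt (i j : ℕ) (f : Code) : Code := fun p =>
  let body := f (p + 2)
  .jumpLt i j (p + 2) :: .jump (p + 2 + body.length + 1) :: (body ++ [.jump p])

/-- Started with the memory `m`, the code `f` arrives within `t` steps at its end, with a memory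
that satisfies `Q`, wherever it stands in a program. -/
def Runs (inp : Input) (f : Code) (m : Memory) (t : ℕ) (Q : Memory → Prop) : Prop :=
  ∀ prog p, Placed prog p (f p) →
    Reaches prog inp (m.atPos p) t fun c => c.pc = p + (f p).length ∧ Q c.mem

/-- The weakest precondition of straight-line code: the instructions in a list are executed one
after another, without jumps or divisions by zero, and lead to a memory that satisfies `Q`. -/
def BlockWP (inp : Input) : List Instr → (Memory → Prop) → Memory → Prop
  | [], Q, m => Q m
  | .wconst i a :: l, Q, m => BlockWP inp l Q (m.setW i a)
  | .wadd i j k :: l, Q, m => BlockWP inp l Q (m.setW i (m.w j + m.w k))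
  | .wsub i j k :: l, Q, m => BlockWP inp l Q (m.setW i (m.w j - m.w k))
  | .wload i j :: l, Q, m => BlockWP inp l Q (m.setW i (m.w (m.w j)))
  | .wstore i j :: l, Q, m => BlockWP inp l Q (m.setW (m.w i) (m.w j))
  | .wread i j :: l, Q, m => BlockWP inp l Q (m.setW i (inp.words.getD (m.w j) 0))
  | .rconst i a :: l, Q, m => BlockWP inp l Q (m.setR i a)
  | .radd i j k :: l, Q, m => BlockWP inp l Q (m.setR i (m.r j + m.r k))
  | .rsub i j k :: l, Q, m => BlockWP inp l Q (m.setR i (m.r j - m.r k))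
  | .rmul i j k :: l, Q, m => BlockWP inp l Q (m.setR i (m.r j * m.r k))
  | .rdiv i j k :: l, Q, m => m.r k ≠ 0 ∧ BlockWP inp l Q (m.setR i (m.r j / m.r k))
  | .rload i j :: l, Q, m => BlockWP inp l Q (m.setR i (m.r (m.w j)))
  | .rstore i j :: l, Q, m => BlockWP inp l Q (m.setR (m.w i) (m.r j))
  | .rread i j :: l, Q, m => BlockWP inp l Q (m.setR i (inp.reals.getD (m.w j) 0))
  | .jump _ :: _, _, _ => False
  | .jumpLt _ _ _ :: _, _, _ => False
  | .jumpNeg _ _ :: _, _, _ => False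

theorem BlockWP.exec {inp : Input} {a : Instr} {l : List Instr} {Q : Memory → Prop} {m : Memory}
    (h : BlockWP inp (a :: l) Q m) (p : ℕ) :
    ∃ m', RealRAM.exec inp (m.atPos p) a = m'.atPos (p + 1) ∧ BlockWP inp l Q m' := by
  cases a with
  | rdiv i j k => exact ⟨m.setR i (m.r j / m.r k), if_neg h.1, h.2⟩
  | jump | jumpLt | jumpNeg => exact h.elim
  | _ => exact ⟨_, rfl, h⟩

namespace Runs

variable {inp : Input} {f g : Code} {m : Memory} {s t t' i j : ℕ} {Q Q' : Memory → Prop}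

theorem mono (h : Runs inp f m t Q) (ht : t ≤ t') (hQ : ∀ m', Q m' → Q' m') :
    Runs inp f m t' Q' :=
  fun prog p hp => (h prog p hp).mono ht fun _ ⟨hpc, hc⟩ => ⟨hpc, hQ _ hc⟩

theorem of_le (h : Runs inp f m t Q) (ht : t ≤ t') : Runs inp f m t' Q :=
  h.mono ht fun _ => id

theorem reaches {prog : List Instr} {c : Config} {p : ℕ} (h : Runs inp f c.mem t Q)
    (hp : Placed prog p (f p)) (hc : c.pc = p) :
    Reaches prog inp c t fun c' => c'.pc = p + (f p).length ∧ Q c'.mem := by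
  subst hc
  exact h prog c.pc hp

theorem block {l : List Instr} (h : BlockWP inp l Q m) : Runs inp (block l) m l.length Q := by
  intro prog p hp
  induction l generalizing m p with
  | nil => exact .refl ⟨rfl, h⟩
  | cons a l ih =>
    obtain ⟨ha, hl⟩ := hp.of_cons
    obtain ⟨m', hexec, hm'⟩ := h.exec p
    refine .next ha (hexec ▸ (ih hm' (p + 1) hl).mono le_rfl fun c ⟨hpc, hQ⟩ => ⟨?_, hQ⟩)
    simp only [hpc, Code.block, List.length_cons]
    omega

theorem seq (h : Runs inp f m s fun m' => Runs inp g m' t Q) :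
    Runs inp (f.seq g) m (s + t) Q := by
  intro prog p hp
  obtain ⟨hf, hg⟩ := hp.of_append
  refine (h prog p hf).trans fun c ⟨hpc, hc⟩ => ?_
  simpa only [Code.seq, List.length_append, add_assoc] using hc.reaches hg hpc

theorem block_seq {l : List Instr} {P : Memory → Prop} (h : BlockWP inp l P m)
    (hg : ∀ m', P m' → Runs inp g m' t Q) : Runs inp ((Code.block l).seq g) m (l.length + t) Q :=
  .seq ((block h).mono le_rfl hg)

theorem ifLt (hf : m.w i < m.w j → Runs inp f m t Q) (hg : ¬ m.w i < m.w j → Runs inp g m t Q) :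
    Runs inp (ifLt i j f g) m (t + 2) Q := by
  intro prog p hp
  obtain ⟨htest, hp⟩ := hp.of_cons
  obtain ⟨helse, hp⟩ := hp.of_append
  obtain ⟨hexit, hthen⟩ := hp.of_cons
  by_cases h : m.w i < m.w j
  · refine .jumpLt_of_lt htest h ((hf h prog _ hthen).mono t.le_succ fun c ⟨hpc, hc⟩ => ⟨?_, hc⟩)
    simp only [hpc, Code.ifLt, List.length_cons, List.length_append]
    omega
  · refine .jumpLt_of_not_lt htest h ((hg h prog _ helse).trans fun c ⟨hpc, hc⟩ => ?_)
    rw [← hpc] at hexit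
    refine .jump hexit ⟨?_, hc⟩
    simp only [Memory.atPos_pc, hpc, Code.ifLt, List.length_cons, List.length_append]
    omega

/-- The loop rule: `I k` is the invariant after `k` rounds, and `b k` bounds the time of the
body in round `k`. -/
theorem whileLt {I : ℕ → Memory → Prop} {N : ℕ} {b : ℕ → ℕ} (hI : I 0 m)
    (hbody : ∀ k < N, ∀ m, I k m → m.w i < m.w j ∧ Runs inp f m (b k) (I (k + 1)))
    (hexit : ∀ m, I N m → ¬ m.w i < m.w j) :
    Runs inp (whileLt i j f) m (∑ k ∈ Finset.range N, (b k + 2) + 2) (I N) := by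
  intro prog p hp
  obtain ⟨htest, hp⟩ := hp.of_cons
  obtain ⟨hleave, hp⟩ := hp.of_cons
  obtain ⟨hf, hp⟩ := hp.of_append
  obtain ⟨hback, -⟩ := hp.of_cons
  have hrounds : ∀ k ≤ N, Reaches prog inp (m.atPos p) (∑ k ∈ Finset.range k, (b k + 2))
      fun c => c.pc = p ∧ I k c.mem := by
    intro k hk
    induction k with
    | zero => exact .refl ⟨rfl, hI⟩
    | succ k ih =>
      rw [Finset.sum_range_succ]
      refine (ih (by omega)).trans fun c ⟨hpc, hc⟩ => ?_
      obtain ⟨hlt, hrun⟩ := hbody k hk _ hc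
      exact .jumpLt_of_lt (hpc ▸ htest) hlt ((hrun prog _ hf).trans fun c ⟨hpc, hc⟩ =>
        .jump (hpc ▸ hback) ⟨rfl, hc⟩)
  refine (hrounds N le_rfl).trans fun c ⟨hpc, hc⟩ => ?_
  subst hpc
  refine .jumpLt_of_not_lt htest (hexit _ hc) (.jump hleave ⟨?_, hc⟩)
  simp only [Memory.atPos_pc, Code.whileLt, List.length_cons, List.length_append, List.length_nil]
  omega

/-- The loop rule for a loop that processes a list: `I l` is the invariant when the members of
`l` are still to be processed. -/
theorem whileLt_list {α : Type*} {I : List α → Memory → Prop} {l : List α} {b : ℕ} (hI : I l m)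
    (hbody : ∀ a l', a :: l' <:+ l → ∀ m, I (a :: l') m → m.w i < m.w j ∧ Runs inp f m b (I l'))
    (hexit : ∀ m, I [] m → ¬ m.w i < m.w j) :
    Runs inp (Code.whileLt i j f) m (l.length * (b + 2) + 2) (I []) := by
  have := whileLt (inp := inp) (f := f) (I := fun k => I (l.drop k)) (N := l.length)
    (b := fun _ => b) (i := i) (j := j) (m := m) (by simpa using hI)
    (fun k hk m hm => hbody l[k] (l.drop (k + 1)) (List.drop_eq_getElem_cons hk ▸ l.drop_suffix k) m
      (by rwa [← List.drop_eq_getElem_cons hk])) (by simpa using hexit)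
  simpa using this

end Runs

end Code

end RealRAM

/-- The value of a gate at the point `z`, from the values of its children. -/
def PGCGate.eval {n : ℕ} {V : Type} (z : Fin n → ℝ) (val : V → ℝ) : PGCGate n V → ℝ
  | var i => z i
  | const c => c
  | sum l => (l.map fun a => a.1 * val a.2).sum
  | prod l => (l.map val).prod

namespace RealRAM

open Code

namespace Reg

-- Registers for natural numbers. The reading positions in the two parts of the input are `pos` and
-- `realPos`.
@[simp] abbrev zero : ℕ := 0
@[simp] abbrev one : ℕ := 1
@[simp] abbrev two : ℕ := 2
@[simp] abbrev base : ℕ := 3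
@[simp] abbrev firstGate : ℕ := 4
@[simp] abbrev numNodes : ℕ := 5
@[simp] abbrev numPoints : ℕ := 6
@[simp] abbrev point : ℕ := 7
@[simp] abbrev node : ℕ := 8
@[simp] abbrev pos : ℕ := 9
@[simp] abbrev realPos : ℕ := 10
@[simp] abbrev tag : ℕ := 11
@[simp] abbrev arg : ℕ := 12
@[simp] abbrev limit : ℕ := 13

-- Registers for real numbers, numbered separately.
@[simp] abbrev acc : ℕ := 0
@[simp] abbrev unit : ℕ := 1
@[simp] abbrev weight : ℕ := 2
@[simp] abbrev negCard : ℕ := 3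
@[simp] abbrev abscissa : ℕ := 4
@[simp] abbrev value : ℕ := 5
@[simp] abbrev child : ℕ := 6
@[simp] abbrev coeff : ℕ := 7

end Reg

open Reg

/-- The value of node number `i` is kept in the real register `nodeBase + i`. -/
@[simp] abbrev nodeBase : ℕ := 8

/-- The registers that hold constants throughout the main loops. -/
structure Constants (m : Memory) : Prop where
  zero : m.w zero = 0
  one : m.w one = 1
  two : m.w two = 2
  base : m.w base = nodeBase
  unit : m.r unit = 1

/-- The words `ws` and the reals `rs` are what remains of the input from the current reading
positions on. -/
structure Unread (inp : Input) (ws : List ℕ) (rs : List ℝ) (m : Memory) : Prop where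
  words : inp.words.drop (m.w pos) = ws
  reals : inp.reals.drop (m.w realPos) = rs

namespace Unread

variable {inp : Input} {a : ℕ} {c : ℝ} {ws : List ℕ} {rs : List ℝ} {m : Memory}

theorem getElem?_words (h : Unread inp (a :: ws) rs m) : inp.words[m.w pos]?.getD 0 = a := by
  rw [← Nat.add_zero (m.w pos), ← List.getElem?_drop, h.words]
  rfl

theorem drop_words_succ (h : Unread inp (a :: ws) rs m) : inp.words.drop (m.w pos + 1) = ws := by
  rw [← List.tail_drop, h.words, List.tail_cons]

theorem getElem?_reals (h : Unread inp ws (c :: rs) m) : inp.reals[m.w realPos]?.getD 0 = c := by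
  rw [← Nat.add_zero (m.w realPos), ← List.getElem?_drop, h.reals]
  rfl

theorem drop_reals_succ (h : Unread inp ws (c :: rs) m) :
    inp.reals.drop (m.w realPos + 1) = rs := by
  rw [← List.tail_drop, h.reals, List.tail_cons]

end Unread

/-- The number that the query code `q` of a variable tells the machine to substitute for it, where
`1` stands for the indeterminate of the univariate restriction, whose current value is `x`. -/
def substitute (q : ℕ) (x : ℝ) : ℝ := if 1 < q then 0 else if 0 < q then x else 1

/-- The query code of the `i`-th variable is `q i`. -/
def Input.HasQuery (inp : Input) {n : ℕ} (q : Fin n → ℕ) : Prop :=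
  ∀ i : Fin n, inp.words[(i : ℕ) + 2]?.getD 0 = q i

section GateCode

/-- Evaluates a variable leaf. The query code of variable `i` stands at position `i + 2` of the
input. -/
def varCode : Code :=
  seq (block [.wread arg pos, .wadd pos pos one, .wadd arg arg two, .wread arg arg,
    .rconst value 0]) <|
  ifLt one arg (block []) <|
  ifLt zero arg (block [.radd value value abscissa]) <|
  block [.radd value value unit]

/-- Evaluates a constant leaf. -/
def constCode : Code := block [.rread value realPos, .wadd realPos realPos one]

/-- Evaluates a sum node, when `limit` is the position behind the list of its children. -/
def sumCode : Code :=
  seq (block [.rconst value 0]) <|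
  whileLt pos limit <|
  block [.wread arg pos, .wadd pos pos one, .wadd arg base arg, .rload child arg,
    .rread coeff realPos, .wadd realPos realPos one, .rmul child coeff child,
    .radd value value child]

/-- Evaluates a product node, when `limit` is the position behind the list of its children. -/
def prodCode : Code :=
  seq (block [.rconst value 1]) <|
  whileLt pos limit <|
  block [.wread arg pos, .wadd pos pos one, .wadd arg base arg, .rload child arg,
    .rmul value value child]

/-- Evaluates a leaf, when its kind has been read. -/
def leafCode : Code := ifLt tag one varCode constCode

/-- Evaluates an inner node, when its kind has been read. -/
def innerCode : Code :=
  seq (block [.wread arg pos, .wadd pos pos one, .wadd limit arg pos]) <|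
  ifLt two tag prodCode sumCode

/-- Evaluates the gate at the current reading positions. -/
def gateCode : Code :=
  seq (block [.wread tag pos, .wadd pos pos one]) <|
  ifLt tag two leafCode innerCode

/-- The natural registers to which `gateCode` writes. -/
abbrev gateWordRegs : Set ℕ := {pos, realPos, tag, arg, limit}

/-- The real registers to which `gateCode` writes. -/
abbrev gateRealRegs : Set ℕ := {value, child, coeff}

/-- What the evaluation of a gate with value `x` does to the memory `m`, when `ws` and `rs` are
the inputs that stand behind the gate. -/
structure GateEvaluated (inp : Input) (ws : List ℕ) (rs : List ℝ) (x : ℝ) (m m' : Memory) :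
    Prop where
  unread : Unread inp ws rs m'
  value : m'.r value = x
  eqOff : m.EqOff gateWordRegs gateRealRegs m'

variable {inp : Input} {ws : List ℕ} {rs : List ℝ} {m : Memory} {n : ℕ} {V : Type}
  {idx : V → ℕ} {val : V → ℝ}

theorem nodeBase_add_notMem (i : ℕ) : nodeBase + i ∉ gateRealRegs := by
  simp only [nodeBase, value, child, coeff, Set.mem_insert_iff, Set.mem_singleton_iff]
  omega

namespace Constants

theorem of_eqOff {W R : Set ℕ} {m' : Memory} (h : Constants m) (h' : m.EqOff W R m')
    (hW : ∀ i ∈ W, Reg.base < i) (hR : Reg.unit ∉ R) : Constants m' where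
  zero := (h'.w _ fun hi => absurd (hW _ hi) (by decide)).trans h.zero
  one := (h'.w _ fun hi => absurd (hW _ hi) (by decide)).trans h.one
  two := (h'.w _ fun hi => absurd (hW _ hi) (by decide)).trans h.two
  base := (h'.w _ fun hi => absurd (hW _ hi) (by decide)).trans h.base
  unit := (h'.r _ hR).trans h.unit

theorem of_eqOff_gateRegs {m' : Memory} (h : Constants m)
    (h' : m.EqOff gateWordRegs gateRealRegs m') : Constants m' :=
  h.of_eqOff h' (by simp) (by simp)

end Constants

theorem blockWP_readTag {a : ℕ} (hm : Constants m) (hu : Unread inp (a :: ws) rs m) :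
    BlockWP inp [.wread tag pos, .wadd pos pos one] (fun m' => m'.w tag = a ∧ Constants m' ∧
      Unread inp ws rs m' ∧ m.EqOff gateWordRegs gateRealRegs m') m :=
  ⟨by simp [hu.getElem?_words], hm.of_eqOff_gateRegs (by simp),
    ⟨by simp [hm.one, hu.drop_words_succ], by simp [hu.reals]⟩, by simp⟩

theorem blockWP_readArity {a : ℕ} (hm : Constants m) (hu : Unread inp (a :: ws) rs m) :
    BlockWP inp [.wread arg pos, .wadd pos pos one, .wadd limit arg pos] (fun m' =>
      m'.w limit = m'.w pos + a ∧ m'.w tag = m.w tag ∧ Constants m' ∧ Unread inp ws rs m' ∧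
      m.EqOff gateWordRegs gateRealRegs m') m :=
  ⟨by simp [hu.getElem?_words, add_comm], by simp, hm.of_eqOff_gateRegs (by simp),
    ⟨by simp [hm.one, hu.drop_words_succ], by simp [hu.reals]⟩, by simp⟩

theorem runs_constCode {c : ℝ} (hm : Constants m) (hu : Unread inp ws (c :: rs) m) :
    Runs inp constCode m 2 (GateEvaluated inp ws rs c m) :=
  .block ⟨⟨by simp [hu.words], by simp [hm.one, hu.drop_reals_succ]⟩,
    by simp [hu.getElem?_reals], by simp⟩

theorem runs_varCode {q : Fin n → ℕ} {i : Fin n} (hm : Constants m) (hq : inp.HasQuery q)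
    (hu : Unread inp (i :: ws) rs m) :
    Runs inp varCode m 10 (GateEvaluated inp ws rs (substitute (q i) (m.r abscissa)) m) := by
  refine .block_seq (P := fun m' => m'.w arg = q i ∧ GateEvaluated inp ws rs 0 m m') (t := 5)
    ⟨by simp [hm.two, hu.getElem?_words, hq i],
      ⟨by simp [hm.one, hu.drop_words_succ], by simp [hu.reals]⟩, by simp, by simp⟩ ?_
  rintro m' ⟨harg, h⟩
  have hm' := hm.of_eqOff_gateRegs h.eqOff
  have hx : m'.r abscissa = m.r abscissa := h.eqOff.r _ (by simp)
  have ⟨⟨hwords, hreals⟩, hvalue, heqOff⟩ := h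
  refine .ifLt (t := 3) (fun h1 => ?_) fun h1 => .ifLt (t := 1) (fun h0 => ?_) fun h0 => ?_ <;>
    rw [hm'.one, harg] at h1
  · refine .mono (.block (Q := GateEvaluated inp ws rs _ m) h) (Nat.zero_le 3) fun _ h => ?_
    simpa only [substitute, if_pos h1] using h
  · rw [hm'.zero, harg] at h0
    exact .block ⟨⟨hwords, hreals⟩, by simp [substitute, h1, h0, hvalue, hx], by simp [heqOff]⟩
  · rw [hm'.zero, harg] at h0
    exact .block ⟨⟨hwords, hreals⟩, by simp [substitute, h1, h0, hvalue, hm'.unit],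
      by simp [heqOff]⟩

/-- In the loop over the edges into a sum node, the value `x` of the node is the accumulated value
plus the terms of the edges `l` that are still to come. -/
structure SumInvariant (inp : Input) (ws : List ℕ) (rs : List ℝ) (idx : V → ℕ) (val : V → ℝ)
    (x : ℝ) (m : Memory) (l : List (ℝ × V)) (m' : Memory) : Prop where
  unread : Unread inp (l.map (fun a => idx a.2) ++ ws) (l.map Prod.fst ++ rs) m'
  limit : m'.w limit = m'.w pos + l.length
  value : m'.r value + (l.map fun a => a.1 * val a.2).sum = x
  eqOff : m.EqOff gateWordRegs gateRealRegs m'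

theorem runs_sumCode {l : List (ℝ × V)} (hm : Constants m)
    (hu : Unread inp (l.map (fun a => idx a.2) ++ ws) (l.map Prod.fst ++ rs) m)
    (hlimit : m.w limit = m.w pos + l.length)
    (hval : ∀ a ∈ l, m.r (nodeBase + idx a.2) = val a.2) :
    Runs inp sumCode m (10 * l.length + 3)
      (GateEvaluated inp ws rs (l.map fun a => a.1 * val a.2).sum m) := by
  have hstart : BlockWP inp [.rconst value 0] (SumInvariant inp ws rs idx val
      (l.map fun a => a.1 * val a.2).sum m l) m :=
    ⟨⟨by simp [hu.words], by simp [hu.reals]⟩, by simp [hlimit], by simp, by simp⟩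
  refine .mono (.block_seq hstart fun m₁ h₁ => .whileLt_list (b := 8) h₁ (fun a l' hl m' h => ?_)
    fun m' h => h.limit.le.not_gt) (by simp; omega)
    fun m' h => ⟨h.unread, by simpa using h.value, h.eqOff⟩
  have hm' := hm.of_eqOff_gateRegs h.eqOff
  have hchild : m'.r (nodeBase + idx a.2) = val a.2 := by
    rw [h.eqOff.r _ (nodeBase_add_notMem _), hval a (hl.subset List.mem_cons_self)]
  have hlimit := h.limit
  have hvalue := h.value
  have hu := h.unread
  refine ⟨by simp [hlimit], .block ⟨⟨?_, ?_⟩, ?_, ?_, by simp [h.eqOff]⟩⟩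
  · simp [hm'.one, hu.drop_words_succ]
  · simp [hm'.one, hu.drop_reals_succ]
  · simp [hm'.one, hlimit, add_assoc, add_comm 1]
  · simp [hm'.base, hu.getElem?_words, hu.getElem?_reals, hchild, ← hvalue, add_assoc]

/-- In the loop over the children of a product node, the value `x` of the node is the accumulated
value times the values of the children `l` that are still to come. -/
structure ProdInvariant (inp : Input) (ws : List ℕ) (rs : List ℝ) (idx : V → ℕ) (val : V → ℝ)
    (x : ℝ) (m : Memory) (l : List V) (m' : Memory) : Prop where
  unread : Unread inp (l.map idx ++ ws) rs m'
  limit : m'.w limit = m'.w pos + l.length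
  value : m'.r value * (l.map val).prod = x
  eqOff : m.EqOff gateWordRegs gateRealRegs m'

theorem runs_prodCode {l : List V} (hm : Constants m)
    (hu : Unread inp (l.map idx ++ ws) rs m) (hlimit : m.w limit = m.w pos + l.length)
    (hval : ∀ u ∈ l, m.r (nodeBase + idx u) = val u) :
    Runs inp prodCode m (10 * l.length + 3) (GateEvaluated inp ws rs (l.map val).prod m) := by
  have hstart : BlockWP inp [.rconst value 1] (ProdInvariant inp ws rs idx val
      (l.map val).prod m l) m :=
    ⟨⟨by simp [hu.words], by simp [hu.reals]⟩, by simp [hlimit], by simp, by simp⟩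
  refine .mono (.block_seq hstart fun m₁ h₁ => .whileLt_list (b := 5) h₁ (fun u l' hl m' h => ?_)
    fun m' h => h.limit.le.not_gt) (by simp; omega)
    fun m' h => ⟨h.unread, by simpa using h.value, h.eqOff⟩
  have hm' := hm.of_eqOff_gateRegs h.eqOff
  have hchild : m'.r (nodeBase + idx u) = val u := by
    rw [h.eqOff.r _ (nodeBase_add_notMem _), hval u (hl.subset List.mem_cons_self)]
  have hlimit := h.limit
  have hvalue := h.value
  have hu := h.unread
  refine ⟨by simp [hlimit], .block ⟨⟨?_, by simp [hu.reals]⟩, ?_, ?_, by simp [h.eqOff]⟩⟩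
  · simp [hm'.one, hu.drop_words_succ]
  · simp [hm'.one, hlimit, add_assoc, add_comm 1]
  · simp [hm'.base, hu.getElem?_words, hchild, ← hvalue, mul_assoc]

theorem GateEvaluated.of_eqOff {x : ℝ} {m₁ m₂ : Memory}
    (h : m.EqOff gateWordRegs gateRealRegs m₁) (h' : GateEvaluated inp ws rs x m₁ m₂) :
    GateEvaluated inp ws rs x m m₂ :=
  ⟨h'.unread, h'.value, h.trans h'.eqOff⟩

theorem runs_innerCode_sum {l : List (ℝ × V)} (hm : Constants m) (htag : m.w tag = 2)
    (hu : Unread inp (l.length :: l.map (fun a => idx a.2) ++ ws) (l.map Prod.fst ++ rs) m)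
    (hval : ∀ a ∈ l, m.r (nodeBase + idx a.2) = val a.2) :
    Runs inp innerCode m (10 * l.length + 8)
      (GateEvaluated inp ws rs (l.map fun a => a.1 * val a.2).sum m) := by
  refine .of_le (.block_seq (blockWP_readArity hm hu) fun m₁ ⟨hlimit, htag₁, hm₁, hu₁, h₁⟩ => ?_)
    (t := 3 + (10 * l.length + 3 + 2)) (by omega)
  refine .ifLt (fun h => absurd h (by simp [htag₁, htag, hm₁.two])) fun _ => ?_
  refine (runs_sumCode hm₁ hu₁ hlimit fun a ha => ?_).mono le_rfl fun _ => .of_eqOff h₁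
  rw [h₁.r _ (nodeBase_add_notMem _), hval a ha]

theorem runs_innerCode_prod {l : List V} (hm : Constants m) (htag : m.w tag = 3)
    (hu : Unread inp (l.length :: l.map idx ++ ws) rs m)
    (hval : ∀ u ∈ l, m.r (nodeBase + idx u) = val u) :
    Runs inp innerCode m (10 * l.length + 8) (GateEvaluated inp ws rs (l.map val).prod m) := by
  refine .of_le (.block_seq (blockWP_readArity hm hu) fun m₁ ⟨hlimit, htag₁, hm₁, hu₁, h₁⟩ => ?_)
    (t := 3 + (10 * l.length + 3 + 2)) (by omega)
  refine .ifLt (fun _ => ?_) fun h => absurd (by simp [htag₁, htag, hm₁.two]) h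
  refine (runs_prodCode hm₁ hu₁ hlimit fun u hu => ?_).mono le_rfl fun _ => .of_eqOff h₁
  rw [h₁.r _ (nodeBase_add_notMem _), hval u hu]

theorem runs_gateCode {q : Fin n → ℕ} {g : PGCGate n V} (hm : Constants m) (hq : inp.HasQuery q)
    (hu : Unread inp (g.words idx ++ ws) (g.reals ++ rs) m)
    (hval : ∀ u ∈ g.children, m.r (nodeBase + idx u) = val u) :
    Runs inp gateCode m (10 * g.children.length + 16)
      (GateEvaluated inp ws rs (g.eval (fun i => substitute (q i) (m.r abscissa)) val) m) := by
  have hval' {m' : Memory} (h : m.EqOff gateWordRegs gateRealRegs m') :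
      ∀ u ∈ g.children, m'.r (nodeBase + idx u) = val u := fun u hu => by
    rw [h.r _ (nodeBase_add_notMem _), hval u hu]
  cases g with
  | var i =>
    refine .block_seq (blockWP_readTag hm hu) fun m₁ ⟨htag, hm₁, hu₁, h₁⟩ => .ifLt (t := 12)
      (fun _ => .ifLt (fun _ => ?_) fun h => ?_) fun h => ?_
    · rw [← h₁.r abscissa (by simp)]
      exact (runs_varCode hm₁ hq hu₁).mono le_rfl fun _ => .of_eqOff h₁
    · simp [htag, hm₁.one] at h
    · simp [htag, hm₁.two] at h
  | const c =>
    refine .block_seq (blockWP_readTag hm hu) fun m₁ ⟨htag, hm₁, hu₁, h₁⟩ => .ifLt (t := 12)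
      (fun _ => .ifLt (fun h => ?_) fun _ => ?_) fun h => ?_
    · simp [htag, hm₁.one] at h
    · exact (runs_constCode hm₁ hu₁).mono (by omega) fun _ => .of_eqOff h₁
    · simp [htag, hm₁.two] at h
  | sum l =>
    refine .of_le (.block_seq (blockWP_readTag hm hu) fun m₁ ⟨htag, hm₁, hu₁, h₁⟩ =>
      .ifLt (t := 10 * l.length + 8) (fun h => ?_) fun _ => ?_) (by simp [PGCGate.children]; omega)
    · simp [htag, hm₁.two] at h
    · exact (runs_innerCode_sum hm₁ htag hu₁ fun a ha =>
        hval' h₁ _ (List.mem_map_of_mem ha)).mono le_rfl fun _ => .of_eqOff h₁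
  | prod l =>
    refine .of_le (.block_seq (blockWP_readTag hm hu) fun m₁ ⟨htag, hm₁, hu₁, h₁⟩ =>
      .ifLt (t := 10 * l.length + 8) (fun h => ?_) fun _ => ?_) (by simp [PGCGate.children]; omega)
    · simp [htag, hm₁.two] at h
    · exact (runs_innerCode_prod hm₁ htag hu₁ (hval' h₁)).mono le_rfl fun _ => .of_eqOff h₁

end GateCode

end RealRAM

namespace PGC

variable {n : ℕ}

theorem eval_nodePolynomial (P : PGC n) (z : Fin n → ℝ) (v : P.Node) :
    MvPolynomial.eval z (P.nodePolynomial v) =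
      (P.gate v).eval z fun u => MvPolynomial.eval z (P.nodePolynomial u) := by
  rw [nodePolynomial_eq]
  cases P.gate v with
  | var i => exact MvPolynomial.eval_X i
  | const c => exact MvPolynomial.eval_C c
  | sum l =>
    simp only [PGCGate.combine, PGCGate.eval, map_list_sum, List.map_map, Function.comp_def,
      map_mul, MvPolynomial.eval_C]
  | prod l =>
    simp only [PGCGate.combine, PGCGate.eval, map_list_prod, List.map_map, Function.comp_def]

theorem card_node_le_size (P : PGC n) : Fintype.card P.Node ≤ P.size + 1 := by
  classical
  have hsubset : Finset.univ.erase P.root ⊆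
      Finset.univ.biUnion fun v => (P.gate v).children.toFinset := by
    intro u hu
    obtain ⟨v, hv⟩ := not_forall_not.1 (mt (P.no_parent_iff u).1 (Finset.ne_of_mem_erase hu))
    exact Finset.mem_biUnion.2 ⟨v, Finset.mem_univ v, List.mem_toFinset.2 hv⟩
  calc Fintype.card P.Node
      = (Finset.univ.erase P.root).card + 1 :=
        (Finset.card_erase_add_one (Finset.mem_univ P.root)).symm
    _ ≤ ∑ v, (P.gate v).children.toFinset.card + 1 :=
        Nat.succ_le_succ ((Finset.card_le_card hsubset).trans Finset.card_biUnion_le)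
    _ ≤ P.size + 1 :=
        Nat.succ_le_succ (Finset.sum_le_sum fun v _ => List.toFinset_card_le _)

namespace BottomUpOrder

variable {P : PGC n} (e : P.BottomUpOrder)

/-- The number of a node in the bottom-up order. -/
def index (v : P.Node) : ℕ := e.toEquiv.symm v

theorem index_root_add_one : e.index P.root + 1 = Fintype.card P.Node := by
  have hpos : 0 < Fintype.card P.Node := Fintype.card_pos_iff.2 ⟨P.root⟩
  have hroot : e.toEquiv ⟨Fintype.card P.Node - 1, by omega⟩ = P.root := by
    refine (P.no_parent_iff _).1 fun v hv => ?_
    have hlt := e.lt_of_child _ v hv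
    rw [Equiv.symm_apply_apply, Fin.lt_def] at hlt
    exact absurd (e.toEquiv.symm v).isLt (by simp only at hlt; omega)
  rw [index, ← hroot, Equiv.symm_apply_apply]
  exact Nat.sub_add_cancel hpos

/-- The blocks of natural numbers that describe the gates, in the bottom-up order. -/
def gateWords : List (List ℕ) := List.ofFn fun j => (P.gate (e.toEquiv j)).words e.index

/-- The blocks of real numbers that describe the gates, in the bottom-up order. -/
def gateReals : List (List ℝ) := List.ofFn fun j => (P.gate (e.toEquiv j)).reals

theorem flatten_drop_gateWords (j : Fin (Fintype.card P.Node)) :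
    (e.gateWords.drop j).flatten =
      (P.gate (e.toEquiv j)).words e.index ++ (e.gateWords.drop (j + 1)).flatten := by
  rw [List.drop_eq_getElem_cons (by simp [gateWords]), List.flatten_cons]
  simp only [gateWords, List.getElem_ofFn, Fin.eta]

theorem flatten_drop_gateReals (j : Fin (Fintype.card P.Node)) :
    (e.gateReals.drop j).flatten =
      (P.gate (e.toEquiv j)).reals ++ (e.gateReals.drop (j + 1)).flatten := by
  rw [List.drop_eq_getElem_cons (by simp [gateReals]), List.flatten_cons]
  simp only [gateReals, List.getElem_ofFn, Fin.eta]

end BottomUpOrder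

/-- The number by which the input of the machine codes the role of a variable in a query. -/
def queryCode (A B : Finset (Fin n)) (i : Fin n) : ℕ :=
  if i ∈ A then 1 else if i ∈ B then 2 else 0

section Encode

variable {P : PGC n} (e : P.BottomUpOrder) (A B : Finset (Fin n))

theorem encode_words : (P.encode e A B).words =
    n :: Fintype.card P.Node :: (List.ofFn (queryCode A B) ++ e.gateWords.flatten) := rfl

theorem encode_reals : (P.encode e A B).reals = e.gateReals.flatten := rfl

theorem drop_encode_words : (P.encode e A B).words.drop (n + 2) = e.gateWords.flatten := by
  rw [encode_words, List.drop_succ_cons, List.drop_succ_cons]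
  exact List.drop_left' List.length_ofFn

theorem hasQuery_encode : (P.encode e A B).HasQuery (queryCode A B) := fun i => by
  simp [encode_words, List.getElem?_append]

end Encode

end PGC

namespace RealRAM

open Code Reg PGC

theorem substitute_queryCode {n : ℕ} (A B : Finset (Fin n)) (x : ℝ) (i : Fin n) :
    substitute (queryCode A B i) x = queryPoint A B x i := by
  unfold substitute queryCode queryPoint
  split_ifs <;> simp_all

section EvalCode

/-- Evaluates the next gate and stores its value as that of node number `node`. -/
def nodeCode : Code :=
  seq gateCode <|
  block [.wadd arg base node, .rstore arg value, .wadd node node one]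

/-- The evaluation of the circuit at the current point. The root is the last node, whose value is
finally copied to the register `value`. -/
def evalCode : Code :=
  seq (block [.wadd pos firstGate zero, .wconst realPos 0, .wconst node 0]) <|
  seq (whileLt node numNodes nodeCode) <|
  block [.wsub arg numNodes one, .wadd arg base arg, .rload value arg]

/-- The natural registers to which `evalCode` writes. -/
abbrev evalWordRegs : Set ℕ := {node, pos, realPos, tag, arg, limit}

/-- The real registers to which `evalCode` may write; among them are those from `nodeBase` on,
which keep the values of the nodes. -/
abbrev evalRealRegs : Set ℕ := Set.Ici value

variable {n : ℕ} {P : PGC n} (e : P.BottomUpOrder) {A B : Finset (Fin n)} {m m' : Memory} {x : ℝ}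

/-- The registers that depend on the circuit only. -/
structure Loaded (P : PGC n) (m : Memory) : Prop where
  constants : Constants m
  firstGate : m.w firstGate = n + 2
  numNodes : m.w numNodes = Fintype.card P.Node

theorem Loaded.of_eqOff {W R : Set ℕ} (h : Loaded P m) (h' : m.EqOff W R m')
    (hW : ∀ i ∈ W, Reg.numNodes < i) (hR : Reg.unit ∉ R) : Loaded P m' where
  constants := h.constants.of_eqOff h' (fun i hi => lt_trans (by decide) (hW i hi)) hR
  firstGate := (h'.w _ fun hi => absurd (hW _ hi) (by decide)).trans h.firstGate
  numNodes := (h'.w _ fun hi => absurd (hW _ hi) (by decide)).trans h.numNodes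

theorem Loaded.of_eqOff_evalRegs (h : Loaded P m) (h' : m.EqOff evalWordRegs evalRealRegs m') :
    Loaded P m' :=
  h.of_eqOff h' (by simp) (by simp)

/-- The invariant of the loop over the nodes, when the first `k` nodes have been evaluated at the
point `z`. -/
structure NodeInvariant (inp : Input) (z : Fin n → ℝ) (m : Memory) (k : ℕ) (m' : Memory) :
    Prop where
  node : m'.w node = k
  unread : Unread inp (e.gateWords.drop k).flatten (e.gateReals.drop k).flatten m'
  values : ∀ v, e.index v < k → m'.r (nodeBase + e.index v) = (P.nodePolynomial v).eval z
  eqOff : m.EqOff evalWordRegs evalRealRegs m'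

theorem runs_nodeCode (hm : Loaded P m) (hx : m.r abscissa = x) (j : Fin (Fintype.card P.Node))
    (h : NodeInvariant e (P.encode e A B) (queryPoint A B x) m j m') :
    Runs (P.encode e A B) nodeCode m' (10 * (P.gate (e.toEquiv j)).children.length + 19)
      (NodeInvariant e (P.encode e A B) (queryPoint A B x) m (j + 1)) := by
  have hm' := hm.of_eqOff_evalRegs h.eqOff
  have hx' : m'.r abscissa = x := (h.eqOff.r _ (by simp)).trans hx
  have hindex : e.index (e.toEquiv j) = j := by simp [BottomUpOrder.index]
  have hu := h.unread
  rw [e.flatten_drop_gateWords, e.flatten_drop_gateReals] at hu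
  refine .seq (t := 3) ((runs_gateCode hm'.constants (hasQuery_encode e A B) hu
    (val := fun u => (P.nodePolynomial u).eval (queryPoint A B x)) fun u hu => ?_).mono le_rfl
    fun m₁ h₁ => .block ?_)
  · exact h.values u (by simpa [BottomUpOrder.index] using e.lt_of_child _ _ hu)
  · have hm₁ := hm'.constants.of_eqOff_gateRegs h₁.eqOff
    have hvalue := h₁.value
    simp only [hx', substitute_queryCode, ← eval_nodePolynomial] at hvalue
    have hnode : m₁.w node = j := (h₁.eqOff.w _ (by simp)).trans h.node
    refine ⟨?_, ⟨?_, ?_⟩, ?_, ?_⟩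
    · simp [hnode, hm₁.one]
    · simp [h₁.unread.words]
    · simp [h₁.unread.reals]
    · intro v hv
      obtain hlt | heq := (Nat.lt_succ_iff.1 hv).lt_or_eq
      · rw [← h.values v hlt, ← h₁.eqOff.r _ (nodeBase_add_notMem _)]
        simp [hnode, hm₁.base, hlt.ne]
      · obtain rfl : v = e.toEquiv j := e.toEquiv.symm_apply_eq.1 (Fin.ext heq)
        simp [hnode, hm₁.base, heq, hvalue]
    · have hmem : nodeBase + (j : ℕ) ∈ evalRealRegs := by simp; omega
      simpa [hnode, hm₁.base, hmem] using
        h.eqOff.trans (h₁.eqOff.mono (Set.subset_insert ..) (by simp [Set.insert_subset_iff]))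

theorem runs_nodeLoop {m₀ : Memory} (hm : Loaded P m₀) (hx : m₀.r abscissa = x)
    (h : NodeInvariant e (P.encode e A B) (queryPoint A B x) m₀ 0 m) :
    Runs (P.encode e A B) (whileLt node numNodes nodeCode) m
      (10 * P.size + 21 * Fintype.card P.Node + 2)
      (NodeInvariant e (P.encode e A B) (queryPoint A B x) m₀ (Fintype.card P.Node)) := by
  set b : ℕ → ℕ := fun k => if h : k < Fintype.card P.Node then
    10 * (P.gate (e.toEquiv ⟨k, h⟩)).children.length + 19 else 0 with hb
  have htime : ∑ k ∈ Finset.range (Fintype.card P.Node), (b k + 2) =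
      10 * P.size + 21 * Fintype.card P.Node := by
    simp only [Finset.sum_range, hb, Fin.is_lt, dite_true, Fin.eta, Finset.sum_add_distrib,
      ← Finset.mul_sum, Finset.sum_const, Finset.card_univ, Finset.card_range,
      Fintype.card_fin, smul_eq_mul, PGC.size]
    rw [Equiv.sum_comp e.toEquiv fun u => (P.gate u).children.length]
    ring
  refine htime ▸ .whileLt h (fun k hk m' h => ⟨?_, ?_⟩) fun m' h => ?_
  · rwa [h.node, (hm.of_eqOff_evalRegs h.eqOff).numNodes]
  · simpa only [hb, dif_pos hk] using runs_nodeCode e hm hx ⟨k, hk⟩ h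
  · rw [h.node, (hm.of_eqOff_evalRegs h.eqOff).numNodes]
    exact lt_irrefl _

theorem runs_evalCode (hm : Loaded P m) :
    Runs (P.encode e A B) evalCode m (10 * P.size + 21 * Fintype.card P.Node + 8) fun m' =>
      m'.r value = P.polynomial.eval (queryPoint A B (m.r abscissa)) ∧
        m.EqOff evalWordRegs evalRealRegs m' := by
  have hstart : BlockWP (P.encode e A B)
      [.wadd pos firstGate zero, .wconst realPos 0, .wconst node 0]
      (NodeInvariant e (P.encode e A B) (queryPoint A B (m.r abscissa)) m 0) m :=
    ⟨by simp, ⟨by simp [hm.firstGate, hm.constants.zero, drop_encode_words],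
      by simp [encode_reals]⟩, by simp, by simp⟩
  refine .of_le (.block_seq hstart fun m₁ h₁ => .seq ((runs_nodeLoop e hm rfl h₁).mono le_rfl
    fun m' h => .block (l := [_, _, _]) ⟨?_, by simp [h.eqOff]⟩)) (by simp; omega)
  have hm' := hm.of_eqOff_evalRegs h.eqOff
  have hroot := h.values P.root (by have := e.index_root_add_one; omega)
  simpa [hm'.constants.one, hm'.constants.base, hm'.numNodes, ← e.index_root_add_one,
    PGC.polynomial] using hroot

end EvalCode

end RealRAM

namespace RealRAM

open Code Reg PGC

variable {n : ℕ} {P : PGC n} (e : P.BottomUpOrder) (A B : Finset (Fin n)) {m m' : Memory}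

section CountCode

/-- Counts one more variable that has the value 1 in the query: from `k` to `k + 1` such variables,
the weight `differenceWeight k 0` is divided by `-k - 1`. -/
def incrementCode : Code :=
  block [.wadd numPoints numPoints one, .rsub negCard negCard unit, .rdiv weight weight negCard]

/-- One round of the loop that reads the roles of the variables in the query. -/
def countCode : Code :=
  seq (block [.wread tag pos, .wadd pos pos one]) <|
  ifLt zero tag (ifLt tag two incrementCode (block [])) (block [])

/-- The registers of the main loop, prepared for a query in which `k` variables have the
value 1. -/
structure Counted (P : PGC n) (k : ℕ) (m : Memory) : Prop where
  loaded : Loaded P m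
  point : m.w point = 0
  numPoints : m.w numPoints = k + 1
  acc : m.r acc = 0
  abscissa : m.r abscissa = 0
  negCard : m.r negCard = -k
  weight : m.r weight = differenceWeight k 0

variable {k : ℕ}

theorem Counted.of_eqOff (h : Counted P k m) (h' : m.EqOff {tag, pos} ∅ m') : Counted P k m' where
  loaded := h.loaded.of_eqOff h' (by simp) (by simp)
  point := (h'.w _ (by simp)).trans h.point
  numPoints := (h'.w _ (by simp)).trans h.numPoints
  acc := (h'.r _ (by simp)).trans h.acc
  abscissa := (h'.r _ (by simp)).trans h.abscissa
  negCard := (h'.r _ (by simp)).trans h.negCard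
  weight := (h'.r _ (by simp)).trans h.weight

theorem runs_incrementCode {i : ℕ} (hpos : m.w pos = i) (h : Counted P k m) :
    Runs (P.encode e A B) incrementCode m 3 fun m' => m'.w pos = i ∧ Counted P (k + 1) m' := by
  have hone := h.loaded.constants.one
  have hunit := h.loaded.constants.unit
  have hne : (-k - 1 : ℝ) ≠ 0 := by
    rw [← neg_add', neg_ne_zero]
    positivity
  refine .block ⟨by simpa [h.negCard, hunit] using hne, by simp [hpos], ?_, ?_, ?_, ?_, ?_, ?_, ?_⟩
  · exact h.loaded.of_eqOff (W := {numPoints}) (R := {negCard, weight}) (by simp) (by simp)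
      (by simp)
  · simp [h.point]
  · simp [h.numPoints, hone]
  · simp [h.acc]
  · simp [h.abscissa]
  · simp [h.negCard, hunit, sub_eq_add_neg, add_comm]
  · simp [h.negCard, h.weight, hunit, differenceWeight_succ_zero]

/-- The invariant of the loop over the variables, when the first `i` variables have been read. -/
def CountInvariant (P : PGC n) (A : Finset (Fin n)) (i : ℕ) (m : Memory) : Prop :=
  m.w pos = i + 2 ∧ Counted P (A.filter (·.val < i)).card m

theorem card_filter_val_lt_succ (i : Fin n) :
    (A.filter (·.val < i.val + 1)).card =
      (A.filter (·.val < i.val)).card + if i ∈ A then 1 else 0 := by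
  have hfilter : A.filter (·.val < i.val + 1) = A.filter (·.val < i.val) ∪ A.filter (· = i) := by
    rw [← Finset.filter_or]
    simp only [Nat.lt_succ_iff_lt_or_eq, Fin.ext_iff]
  rw [hfilter, Finset.card_union_of_disjoint, Finset.filter_eq']
  · split_ifs <;> rfl
  · exact Finset.disjoint_filter.2 fun j _ hlt heq => (heq ▸ hlt).false

theorem runs_countCode (i : Fin n) (h : CountInvariant P A i m) :
    Runs (P.encode e A B) countCode m 9 (CountInvariant P A (i + 1)) := by
  obtain ⟨hpos, h⟩ := h
  have hq := hasQuery_encode e A B i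
  refine .block_seq (t := 7) (P := fun m' => m'.w tag = queryCode A B i ∧
    m'.w pos = i + 1 + 2 ∧ Counted P (A.filter (·.val < i.val)).card m')
    ⟨by simp [hpos, hq], by simp [hpos, h.loaded.constants.one], h.of_eqOff (by simp)⟩ ?_
  rintro m' ⟨htag, hpos, h⟩
  have hconst := h.loaded.constants
  unfold CountInvariant
  rw [card_filter_val_lt_succ]
  refine .ifLt (t := 5) (fun h0 => .ifLt (t := 3) (fun h2 => ?_) fun h2 => ?_) fun h0 => ?_
  · rw [hconst.zero, htag] at h0
    rw [hconst.two, htag] at h2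
    have hA : i ∈ A := by
      by_contra hA
      simp only [queryCode, if_neg hA] at h0 h2
      split_ifs at h0 h2 <;> omega
    rw [if_pos hA]
    exact runs_incrementCode e A B hpos h
  · rw [hconst.two, htag] at h2
    have hA : i ∉ A := fun hA => h2 (by simp [queryCode, hA])
    rw [if_neg hA]
    exact .of_le (.block ⟨hpos, h⟩) (by simp)
  · rw [hconst.zero, htag] at h0
    have hA : i ∉ A := fun hA => h0 (by simp [queryCode, hA])
    rw [if_neg hA]
    exact .of_le (.block ⟨hpos, h⟩) (by simp)

end CountCode

section PointCode

/-- One round of the loop over the points: adds the weighted value of the circuit to the sum, and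
passes to the next weight with the recurrence `differenceWeight_succ`. -/
def pointCode : Code :=
  seq evalCode <|
  block [.rmul value value weight, .radd acc acc value, .radd child abscissa negCard,
    .rmul weight weight child, .radd abscissa abscissa unit, .rdiv weight weight abscissa,
    .wadd point point one]

/-- The invariant of the loop over the points, when the circuit has been evaluated at the first
`j` points. -/
structure PointInvariant (P : PGC n) (A B : Finset (Fin n)) (j : ℕ) (m : Memory) : Prop where
  loaded : Loaded P m
  point : m.w point = j
  numPoints : m.w numPoints = A.card + 1
  acc : m.r acc = ∑ i ∈ Finset.range j,
    differenceWeight A.card i * P.polynomial.eval (queryPoint A B i)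
  abscissa : m.r abscissa = j
  negCard : m.r negCard = -A.card
  weight : m.r weight = differenceWeight A.card j

variable {A B}

theorem Counted.pointInvariant (h : Counted P A.card m) : PointInvariant P A B 0 m :=
  ⟨h.loaded, h.point, h.numPoints, by simpa using h.acc, by simpa using h.abscissa, h.negCard,
    h.weight⟩

theorem runs_pointCode {j : ℕ} (h : PointInvariant P A B j m) :
    Runs (P.encode e A B) pointCode m (10 * P.size + 21 * Fintype.card P.Node + 15)
      (PointInvariant P A B (j + 1)) := by
  refine .seq (t := 7) ((runs_evalCode e h.loaded).mono le_rfl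
    fun m₁ ⟨hvalue, h₁⟩ => .block ?_)
  have hloaded := h.loaded.of_eqOff_evalRegs h₁
  have hone := hloaded.constants.one
  have hunit := hloaded.constants.unit
  have hpoint : m₁.w point = j := (h₁.w _ (by simp)).trans h.point
  have hnumPoints := (h₁.w numPoints (by simp)).trans h.numPoints
  have hacc := (h₁.r acc (by simp)).trans h.acc
  have habscissa := (h₁.r abscissa (by simp)).trans h.abscissa
  have hnegCard := (h₁.r negCard (by simp)).trans h.negCard
  have hweight := (h₁.r weight (by simp)).trans h.weight
  rw [h.abscissa] at hvalue
  have hne : (j : ℝ) + 1 ≠ 0 := by positivity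
  refine ⟨by simpa [habscissa, hunit] using hne, ?_, ?_, ?_, ?_, ?_, ?_, ?_⟩
  · exact hloaded.of_eqOff (W := {point}) (R := {value, acc, child, weight, abscissa}) (by simp)
      (by simp) (by simp)
  · simp [hpoint, hone]
  · simp [hnumPoints]
  · simp [hacc, hvalue, hweight, Finset.sum_range_succ, mul_comm]
  · simp [habscissa, hunit]
  · simp [hnegCard]
  · simp [hweight, habscissa, hnegCard, hunit, differenceWeight_succ, sub_eq_add_neg]

end PointCode

section MarginalCode

/-- Initializes the registers; those that are not mentioned start with 0. -/
def setupCode : Code :=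
  block [.wconst one 1, .wconst two 2, .wconst base 8, .wread firstGate zero,
    .wadd firstGate firstGate two, .wread numNodes one, .wconst pos 2, .wconst numPoints 1,
    .rconst unit 1, .rconst weight 1]

/-- The computation of a marginal probability: counts the variables with the value 1 in the query,
and sums the weighted values of the circuit at the points. -/
def marginalCode : Code :=
  seq setupCode <|
  seq (whileLt pos firstGate countCode) <|
  whileLt point numPoints pointCode

/-- The code `marginalCode`, placed at the start of a program. -/
def marginalProgram : List Instr := marginalCode 0

theorem runs_setupCode :
    Runs (P.encode e A B) setupCode start.mem 10 (CountInvariant P A 0) := by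
  refine .block ⟨?_, ⟨⟨?_, ?_, ?_, ?_, ?_⟩, ?_, ?_⟩, ?_, ?_, ?_, ?_, ?_, ?_⟩ <;>
    simp [start, Config.mem, encode_words, differenceWeight_zero_zero]

theorem runs_countLoop (h : CountInvariant P A 0 m) :
    Runs (P.encode e A B) (whileLt pos firstGate countCode) m (11 * n + 2)
      (Counted P A.card) := by
  refine .mono (.whileLt (N := n) (b := fun _ => 9) h (fun i hi m h => ⟨?_, ?_⟩) fun m h => ?_)
    (by simp [mul_comm]) fun m ⟨_, h⟩ => ?_
  · rw [h.1, h.2.loaded.firstGate]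
    omega
  · exact runs_countCode e A B ⟨i, hi⟩ h
  · rw [h.1, h.2.loaded.firstGate]
    exact lt_irrefl _
  · rwa [Finset.filter_true_of_mem fun i _ => i.isLt] at h

theorem runs_pointLoop (h : PointInvariant P A B 0 m) :
    Runs (P.encode e A B) (whileLt point numPoints pointCode) m
      ((A.card + 1) * (10 * P.size + 21 * Fintype.card P.Node + 17) + 2)
      (PointInvariant P A B (A.card + 1)) := by
  refine .of_le (.whileLt (b := fun _ => 10 * P.size + 21 * Fintype.card P.Node + 15) h
    (fun j hj m h => ⟨?_, ?_⟩) fun m h => ?_) (by simp)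
  · rwa [h.point, h.numPoints]
  · exact runs_pointCode e h
  · rw [h.point, h.numPoints]
    exact lt_irrefl _

theorem runs_marginalCode :
    Runs (P.encode e A B) marginalCode start.mem
      (11 * n + (A.card + 1) * (10 * P.size + 21 * Fintype.card P.Node + 17) + 14) fun m =>
      m.r acc = ∑ j ∈ Finset.range (A.card + 1),
        differenceWeight A.card j * P.polynomial.eval (queryPoint A B j) := by
  have hpoints {m : Memory} (h : Counted P A.card m) := runs_pointLoop e A B h.pointInvariant
  refine .mono (.seq ((runs_setupCode e A B).mono le_rfl fun m₁ h₁ =>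
    .seq ((runs_countLoop e A B h₁).mono le_rfl fun m₂ h₂ => hpoints h₂))) ?_ fun m h => h.acc
  omega

theorem computesWithin_marginalProgram :
    ∃ t ≤ 11 * n + (A.card + 1) * (10 * P.size + 21 * Fintype.card P.Node + 17) + 14,
      ComputesWithin marginalProgram (P.encode e A B) t (∑ j ∈ Finset.range (A.card + 1),
        differenceWeight A.card j * P.polynomial.eval (queryPoint A B j)) := by
  obtain ⟨t, ht, hpc, hacc⟩ := (runs_marginalCode e A B).reaches (prog := marginalProgram)
    (c := start) (p := 0) (List.prefix_refl _) rfl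
  exact ⟨t, ht, by rw [hpc, zero_add]; rfl, hacc⟩

end MarginalCode

end RealRAM

open RealRAM in
theorem mainTheorem3_general :
    ∃ (prog : List Instr) (C : ℕ),
      ∀ (n : ℕ) (P : PGC n) (μ : Measure (Fin n → Bool)) [IsFiniteMeasure μ],
        P.polynomial = generatingPolynomial μ →
        ∀ (e : P.BottomUpOrder) (A B : Finset (Fin n)), Disjoint A B →
          ∃ t ≤ C * (max 1 P.size * max 1 n),
            ComputesWithin prog (P.encode e A B) t (marginal μ A B) := by
  refine ⟨marginalProgram, 173, fun n P μ _ hP e A B hAB => ?_⟩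
  obtain ⟨t, ht, hcomputes⟩ := computesWithin_marginalProgram e A B
  rw [hP, sum_differenceWeight_mul_eval_generatingPolynomial μ hAB] at hcomputes
  refine ⟨t, ht.trans ?_, hcomputes⟩
  have hA : A.card + 1 ≤ 2 * max 1 n := by
    have := card_finset_fin_le A
    omega
  have hround : 10 * P.size + 21 * Fintype.card P.Node + 17 ≤ 69 * max 1 P.size := by
    have := P.card_node_le_size
    omega
  have hn : max 1 n ≤ max 1 P.size * max 1 n := Nat.le_mul_of_pos_left _ (by omega)
  have hprod := Nat.mul_le_mul hA hround
  linarith [le_max_left 1 n, le_max_right 1 n]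

theorem one_lt_log_three : 1 < Real.log 3 :=
  (Real.lt_log_iff_exp_lt (by norm_num)).2 (Real.exp_one_lt_d9.trans (by norm_num))

theorem log_mul_log_log_le {x : ℝ} (hx : 3 ≤ x) :
    Real.log 3 * Real.log (Real.log 3) ≤ Real.log x * Real.log (Real.log x) := by
  have hlog : Real.log 3 ≤ Real.log x := Real.log_le_log (by norm_num) hx
  have hlog_pos : 0 < Real.log 3 := one_pos.trans one_lt_log_three
  exact mul_le_mul hlog (Real.log_le_log hlog_pos hlog) (Real.log_pos one_lt_log_three).le
    (hlog_pos.trans_le hlog).le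

theorem exists_mul_log_mul_log_log_bound (C : ℕ) :
    ∃ D : ℝ, ∀ m n t : ℕ, t ≤ C * (max 1 m * max 1 n) →
      (1 ≤ m → 3 ≤ n → (t : ℝ) ≤ D * (m * n * Real.log n * Real.log (Real.log n))) ∧
      (t : ℝ) ≤ D * (max 1 (m : ℝ) * max 1 (n : ℝ) * max 1 (Real.log n) *
        max 1 (Real.log (Real.log n))) := by
  set δ := Real.log 3 * Real.log (Real.log 3)
  have hδ_pos : 0 < δ :=
    mul_pos (one_pos.trans one_lt_log_three) (Real.log_pos one_lt_log_three)
  refine ⟨C + C / δ, fun m n t ht => ?_⟩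
  have ht : (t : ℝ) ≤ C * (max 1 (m : ℝ) * max 1 (n : ℝ)) := by exact_mod_cast ht
  constructor
  · intro hm hn
    have hm : (1 : ℝ) ≤ m := by exact_mod_cast hm
    have hn : (3 : ℝ) ≤ n := by exact_mod_cast hn
    rw [max_eq_right hm, max_eq_right (by linarith)] at ht
    have hlog := log_mul_log_log_le hn
    calc (t : ℝ) ≤ C * (m * n) := ht
      _ = C / δ * (m * n * δ) := by field_simp
      _ ≤ (C + C / δ) * (m * n * (Real.log n * Real.log (Real.log n))) := by
        gcongr
        exact le_add_of_nonneg_left (by positivity)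
      _ = _ := by ring
  · have hone : (1 : ℝ) ≤ max 1 (Real.log n) * max 1 (Real.log (Real.log n)) :=
      one_le_mul_of_one_le_of_one_le (le_max_left _ _) (le_max_left _ _)
    calc (t : ℝ) ≤ C * (max 1 (m : ℝ) * max 1 (n : ℝ) * 1) := by rwa [mul_one]
      _ ≤ (C + C / δ) * (max 1 (m : ℝ) * max 1 (n : ℝ) *
          (max 1 (Real.log n) * max 1 (Real.log (Real.log n)))) := by
        gcongr
        exact le_add_of_nonneg_right (by positivity)
      _ = _ := by ring

theorem mainTheorem3 :
    ∃ (prog : List RealRAM.Instr) (C : ℝ),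
      ∀ (n : ℕ) (P : PGC n) (μ : Measure (Fin n → Bool)) [IsProbabilityMeasure μ],
        P.polynomial = generatingPolynomial μ →
        ∀ (e : P.BottomUpOrder) (A B : Finset (Fin n)), Disjoint A B →
          ∃ t : ℕ, RealRAM.ComputesWithin prog (P.encode e A B) t (marginal μ A B) ∧
            (1 ≤ P.size → 3 ≤ n →
              (t : ℝ) ≤ C * (P.size * n * Real.log n * Real.log (Real.log n))) ∧
            (t : ℝ) ≤ C * (max 1 (P.size : ℝ) * max 1 (n : ℝ) * max 1 (Real.log n) *
              max 1 (Real.log (Real.log n))) := by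
  obtain ⟨prog, C, hprog⟩ := mainTheorem3_general
  obtain ⟨D, hD⟩ := exists_mul_log_mul_log_log_bound C
  refine ⟨prog, D, fun n P μ _ hP e A B hAB => ?_⟩
  obtain ⟨t, ht, hcomputes⟩ := hprog n P μ hP e A B hAB
  exact ⟨t, hcomputes, hD P.size n t ht⟩
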